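/- **Theorem 3.9 (chain rule).** All spaces $\mathbb{R}^k$ carry the usual scalar product and norm, products of them are Euclidean, and $\mathbb{B}_r$ is the closed ball of radius $r$ around $0$. *Notation.* For $\Omega\subset\mathbb{R}^k$ and $w\in\Omega$, let $\widehat N_\Omega(w)$ be the set of all $\xi$ with $\langle\xi,w'-w\rangle\le o(\|w'-w\|)$ as $w'\to w$ with $w'\in\Omega$, and let $N_\Omega(w)$ be the set of all limits of sequences $\xi_k\in\widehat N_\Omega(w_k)$ with $w_k\in\Omega$, $w_k\to w$; for $w\notin\Omega$ both sets are empty. For $\Omega\subset\mathbb{R}^n\times\mathbb{R}^m$ and $\bar y\in\mathbb{R}^m$, let $N_\Omega(\infty,\bar y)$ be the set of all limits of sequences $\xi_k\in\widehat N_\Omega(x_k,y_k)$ with $(x_k,y_k)\in\Omega$, $\|x_k\|\to\infty$ and $y_k\to\bar y$. The set $\Omega$ is called locally closed at $(\infty,\bar y)$ if there are $R>0$ and a closed neighborhood $V$ of $\bar y$ such that $\{(x,y)\in\Omega \mid \|x\|\ge R,\ y\in V\}$ is closed. For a set-valued mapping $F\colon\mathbb{R}^n\rightrightarrows\mathbb{R}^m$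 let $\mathrm{gph}\,F=\{(x,y)\mid y\in F(x)\}$, $\ker F=\{x\mid 0\in F(x)\}$, $F^{-1}(y)=\{x\mid y\in F(x)\}$, and let $J(F)$ be the set of all $y$ for which there are $(x_k,y_k)\in\mathrm{gph}\,F$ with $\|x_k\|\to\infty$ and $y_k\to y$. The coderivatives $D^*F(\bar x,\bar y),\,D^*F(\infty,\bar y)\colon\mathbb{R}^m\rightrightarrows\mathbb{R}^n$ are $$D^*F(\bar x,\bar y)(v)=\{u\mid (u,-v)\in N_{\mathrm{gph}F}(\bar x,\bar y)\},\qquad D^*F(\infty,\bar y)(v)=\{u\mid (u,-v)\in N_{\mathrm{gph}F}(\infty,\bar y)\}.$$ For $F_1\colon\mathbb{R}^n\rightrightarrows\mathbb{R}^p$ and $F_2\colon\mathbb{R}^p\rightrightarrows\mathbb{R}^m$ let $(F_2\circ F_1)(x)=\{y\mid F_1(x)\cap F_2^{-1}(y)\ne\emptyset\}$, and let $J^\circ(F_2\circ F_1,y)$ be the set of all $z\in\mathbb{R}^p$ for which there are sequences $x_k$, $z_k\in F_1(x_k)$, $y_k\in F_2(z_k)$ with $\|x_k\|\to\infty$, $z_k\to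 z$ and $y_k\to y$. *Statement.* Let $F_1\colon\mathbb{R}^n\rightrightarrows\mathbb{R}^p$ and $F_2\colon\mathbb{R}^p\rightrightarrows\mathbb{R}^m$ be set-valued mappings with closed graphs, let $F:=F_2\circ F_1$, and let $\bar y\in J(F)$. Assume: (a) (boundedness condition) there are constants $R>0$, $R'>0$ and a neighborhood $V$ of $\bar y$ in $\mathbb{R}^m$ such that $F_1(x)\cap F_2^{-1}(y)\subset\mathbb{B}_{R'}$ for all $x\in\mathbb{R}^n\setminus\mathbb{B}_R$ and all $y\in V$; (b) (constraint qualification) $D^*F_2(z,\bar y)(0)\cap\ker D^*F_1(\infty,z)=\{0\}$ for every $z\in J^\circ(F_2\circ F_1,\bar y)$. Then $\mathrm{gph}\,F$ is locally closed at $(\infty,\bar y)$, and for every $v\in\mathbb{R}^m$ $$D^*(F_2\circ F_1)(\infty,\bar y)(v)\ \subset\ \bigcup_{\bar z\in J^\circ(F_2\circ F_1,\bar y)}\bigl(D^*F_1(\infty,\bar z)\circ D^*F_2(\bar z,\bar y)\bigr)(v).$$ -/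

import Mathlib

open Filter Topology

namespace CoderivativeAtInfinity

section SetValuedMaps

variable {E F G : Type*}

/-- The inverse of a set-valued map: `F⁻¹(y) = {x | y ∈ F(x)}`. -/
def inverse (Φ : E → Set F) (y : F) : Set E := {x | y ∈ Φ x}

/-- The composition of set-valued maps: `(Φ₂ ∘ Φ₁)(x) = {y | Φ₁(x) ∩ Φ₂⁻¹(y) ≠ ∅}`. -/
def comp (Φ₂ : F → Set G) (Φ₁ : E → Set F) (x : E) : Set G :=
  {y | (Φ₁ x ∩ inverse Φ₂ y).Nonempty}

/-- The kernel of a set-valued map: `ker Φ = {x | 0 ∈ Φ(x)}`. -/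
def kernel [Zero F] (Φ : E → Set F) : Set E := {x | 0 ∈ Φ x}

/-- The graph of a set-valued map, as a subset of the product with its Euclidean structure. -/
def graph (Φ : E → Set F) : Set (WithLp 2 (E × F)) := {p | p.snd ∈ Φ p.fst}

end SetValuedMaps

section NormalCones

variable {H : Type*} [NormedAddCommGroup H] [InnerProductSpace ℝ H]

/-- The regular (Fréchet) normal cone: all `ξ` with `⟪ξ, x' - x⟫ ≤ o(‖x' - x‖)` as `x' → x`
within `Ω`. It is empty if `x ∉ Ω`. -/
def regularNormalCone (Ω : Set H) (x : H) : Set H :=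
  {ξ | x ∈ Ω ∧ ∀ ε : ℝ, 0 < ε → ∀ᶠ x' in 𝓝[Ω] x, inner ℝ ξ (x' - x) ≤ ε * ‖x' - x‖}

/-- The limiting (Mordukhovich) normal cone. It is empty if `x ∉ Ω`. -/
def limitingNormalCone (Ω : Set H) (x : H) : Set H :=
  {ξ | x ∈ Ω ∧ ∃ (xs : ℕ → H) (ξs : ℕ → H),
    (∀ k, xs k ∈ Ω) ∧ (∀ k, ξs k ∈ regularNormalCone Ω (xs k)) ∧
    Tendsto xs atTop (𝓝 x) ∧ Tendsto ξs atTop (𝓝 ξ)}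

variable {E F G : Type*}
  [NormedAddCommGroup E] [InnerProductSpace ℝ E]
  [NormedAddCommGroup F] [InnerProductSpace ℝ F]
  [NormedAddCommGroup G]

/-- `(x_k, y_k) → (∞, y)`, that is, `‖x_k‖ → ∞` and `y_k → y`. -/
def TendstoInfty (ps : ℕ → WithLp 2 (E × F)) (y : F) : Prop :=
  Tendsto (fun k => ‖(ps k).fst‖) atTop atTop ∧ Tendsto (fun k => (ps k).snd) atTop (𝓝 y)

/-- The normal cone to `Ω` at `(∞, y)`: the outer limit of the regular normal cones at
`(x', y') ∈ Ω` as `(x', y') → (∞, y)`. -/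
def normalConeAtInfty (Ω : Set (WithLp 2 (E × F))) (y : F) : Set (WithLp 2 (E × F)) :=
  {ξ | ∃ (ps : ℕ → WithLp 2 (E × F)) (ξs : ℕ → WithLp 2 (E × F)),
    (∀ k, ps k ∈ Ω) ∧ (∀ k, ξs k ∈ regularNormalCone Ω (ps k)) ∧
    TendstoInfty ps y ∧ Tendsto ξs atTop (𝓝 ξ)}

/-- `Ω` is locally closed at `(∞, y)`: for some `R > 0` and some closed neighborhood `V` of `y`,
the part of `Ω` with `‖x'‖ ≥ R` and `y' ∈ V` is closed. -/
def LocallyClosedAtInfty (Ω : Set (WithLp 2 (E × F))) (y : F) : Prop :=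
  ∃ R : ℝ, 0 < R ∧ ∃ V ∈ 𝓝 y, IsClosed V ∧
    IsClosed {p : WithLp 2 (E × F) | p ∈ Ω ∧ R ≤ ‖p.fst‖ ∧ p.snd ∈ V}

/-- The (basic) coderivative `D*Φ(x, y) : F ⇉ E`. -/
def coderivative (Φ : E → Set F) (x : E) (y : F) (v : F) : Set E :=
  {u | WithLp.toLp 2 (u, -v) ∈ limitingNormalCone (graph Φ) (WithLp.toLp 2 (x, y))}

/-- The coderivative at infinity `D*Φ(∞, y) : F ⇉ E`. -/
def coderivativeAtInfty (Φ : E → Set F) (y : F) (v : F) : Set E :=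
  {u | WithLp.toLp 2 (u, -v) ∈ normalConeAtInfty (graph Φ) y}

/-- The Jelonek set `J(Φ)`: all limits of `y_k ∈ Φ(x_k)` along sequences with `‖x_k‖ → ∞`. -/
def jelonekSet (Φ : E → Set F) : Set F :=
  {y | ∃ ps : ℕ → WithLp 2 (E × F), (∀ k, ps k ∈ graph Φ) ∧ TendstoInfty ps y}

/-- The set `J°(Φ₂ ∘ Φ₁, y)`: all limits of intermediate points `z_k ∈ Φ₁(x_k)` for which there
are `y_k ∈ Φ₂(z_k)` with `‖x_k‖ → ∞` and `y_k → y`. -/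
def jelonekComp (Φ₂ : F → Set G) (Φ₁ : E → Set F) (y : G) : Set F :=
  {z | ∃ (xs : ℕ → E) (zs : ℕ → F) (ys : ℕ → G),
    Tendsto (fun k => ‖xs k‖) atTop atTop ∧
    (∀ k, zs k ∈ Φ₁ (xs k)) ∧ (∀ k, ys k ∈ Φ₂ (zs k)) ∧
    Tendsto zs atTop (𝓝 z) ∧ Tendsto ys atTop (𝓝 y)}

end NormalCones

end CoderivativeAtInfinity

/-! Fix a normal to the graph of the composition at `(∞, y)` and regular normals `(u_k, v_k)` at
`(x_k, y_k)` converging to it. Boundedness confines the intermediate points `z_k`, so they converge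
along a subsequence. The main tool is the fuzzy chain rule `exists_regularNormalCone_near_of_comp`:
up to small errors, `(u_k, v_k)` splits into regular normals `(u_k, -w_k)` to `gph Φ₁` and `(w_k,
v_k)` to `gph Φ₂` near `(x_k, z_k)` and `(z_k, y_k)`. For its proof, `(x₀ + t • u, z₀, y₀ + t • v)`
is projected onto the linked graphs, with the link `z = z'` relaxed to a quadratic penalty. The
minimizer then varies separately in each graph and yields a proximal normal there, with `w` the
scaled gradient of the penalty. The `w_k` may be unbounded. After normalization, a blow-up would
produce a unit vector excluded by the constraint qualification; otherwise the limit is rescaled. -/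

namespace CoderivativeAtInfinity

/-! ### Regular normals and positive scaling -/

section Cones

variable {H : Type*} [NormedAddCommGroup H] [InnerProductSpace ℝ H]

/-- Proximal normals are regular normals. -/
theorem mem_regularNormalCone_of_inner_le_sq {Ω : Set H} {p ξ : H} {C : ℝ} (hp : p ∈ Ω)
    (h : ∀ q ∈ Ω, inner ℝ ξ (q - p) ≤ C * ‖q - p‖ ^ 2) : ξ ∈ regularNormalCone Ω p := by
  refine ⟨hp, fun ε hε => ?_⟩
  have hlim : Tendsto (fun q : H => C * ‖q - p‖) (𝓝 p) (𝓝 0) := by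
    have : Continuous fun q : H => C * ‖q - p‖ := by fun_prop
    simpa using this.tendsto p
  filter_upwards [self_mem_nhdsWithin, nhdsWithin_le_nhds (hlim.eventually_le_const hε)]
    with q hq hle
  calc inner ℝ ξ (q - p) ≤ C * ‖q - p‖ * ‖q - p‖ := by linarith [h q hq, sq ‖q - p‖]
    _ ≤ ε * ‖q - p‖ := by gcongr

theorem smul_mem_regularNormalCone {Ω : Set H} {p ξ : H} {c : ℝ} (hc : 0 < c)
    (h : ξ ∈ regularNormalCone Ω p) : c • ξ ∈ regularNormalCone Ω p := by
  refine ⟨h.1, fun ε hε => ?_⟩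
  filter_upwards [h.2 (ε / c) (by positivity)] with q hq
  rw [real_inner_smul_left]
  calc c * inner ℝ ξ (q - p) ≤ c * (ε / c * ‖q - p‖) := by gcongr
    _ = ε * ‖q - p‖ := by field_simp

theorem smul_mem_limitingNormalCone {Ω : Set H} {p ξ : H} {c : ℝ} (hc : 0 < c)
    (h : ξ ∈ limitingNormalCone Ω p) : c • ξ ∈ limitingNormalCone Ω p := by
  obtain ⟨hp, xs, ξs, h1, h2, h3, h4⟩ := h
  exact ⟨hp, xs, fun k => c • ξs k, h1, fun k => smul_mem_regularNormalCone hc (h2 k), h3,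
    h4.const_smul c⟩

variable {E F : Type*}
  [NormedAddCommGroup E] [InnerProductSpace ℝ E] [NormedAddCommGroup F] [InnerProductSpace ℝ F]

theorem smul_mem_normalConeAtInfty {Ω : Set (WithLp 2 (E × F))} {y : F}
    {ξ : WithLp 2 (E × F)} {c : ℝ} (hc : 0 < c)
    (h : ξ ∈ normalConeAtInfty Ω y) : c • ξ ∈ normalConeAtInfty Ω y := by
  obtain ⟨ps, ξs, h1, h2, h3, h4⟩ := h
  exact ⟨ps, fun k => c • ξs k, h1, fun k => smul_mem_regularNormalCone hc (h2 k), h3,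
    h4.const_smul c⟩

end Cones

/-! ### Closed graphs and local closedness at infinity -/

section Graphs

variable {E F G : Type*} [NormedAddCommGroup E] [NormedAddCommGroup F] [NormedAddCommGroup G]

theorem tendsto_toLp_prodMk {ι : Type*} {l : Filter ι} {a : ι → E} {b : ι → F} {x : E} {y : F}
    (ha : Tendsto a l (𝓝 x)) (hb : Tendsto b l (𝓝 y)) :
    Tendsto (fun i => WithLp.toLp 2 (a i, b i)) l (𝓝 (WithLp.toLp 2 (x, y))) :=
  ((WithLp.prod_continuous_toLp 2 E F).tendsto (x, y)).comp (ha.prodMk_nhds hb)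

theorem mem_of_tendsto_of_isClosed_graph {Φ : E → Set F} (hΦ : IsClosed (graph Φ))
    {a : ℕ → E} {b : ℕ → F} {x : E} {y : F} (ha : Tendsto a atTop (𝓝 x))
    (hb : Tendsto b atTop (𝓝 y)) (h : ∀ᶠ k in atTop, b k ∈ Φ (a k)) : y ∈ Φ x :=
  hΦ.mem_of_tendsto (tendsto_toLp_prodMk ha hb) h

/-- The graph of a composition is locally closed at infinity if the intermediate points stay
bounded. -/
theorem locallyClosedAtInfty_graph_comp [ProperSpace F] {Φ₁ : E → Set F} {Φ₂ : F → Set G}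
    (h₁ : IsClosed (graph Φ₁)) (h₂ : IsClosed (graph Φ₂)) {y : G} {R R' : ℝ} (hR : 0 < R)
    {V : Set G} (hV : V ∈ 𝓝 y)
    (hb : ∀ x : E, x ∉ Metric.closedBall 0 R → ∀ y' ∈ V,
      Φ₁ x ∩ inverse Φ₂ y' ⊆ Metric.closedBall 0 R') :
    LocallyClosedAtInfty (graph (comp Φ₂ Φ₁)) y := by
  obtain ⟨r, hr, hrV⟩ := Metric.nhds_basis_closedBall.mem_iff.1 hV
  -- `R + 1` because the bound on intermediate points needs `‖x‖ > R` strictly.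
  refine ⟨R + 1, by linarith, Metric.closedBall y r, Metric.closedBall_mem_nhds y hr,
    Metric.isClosed_closedBall, IsSeqClosed.isClosed fun ps p hps hp => ?_⟩
  choose zs hzs using fun k => (hps k).1
  have hfst : Tendsto (fun k => (ps k).fst) atTop (𝓝 p.fst) :=
    ((WithLp.prod_continuous_ofLp 2 E G).fst.tendsto p).comp hp
  have hsnd : Tendsto (fun k => (ps k).snd) atTop (𝓝 p.snd) :=
    ((WithLp.prod_continuous_ofLp 2 E G).snd.tendsto p).comp hp
  have hz : ∀ k, zs k ∈ Metric.closedBall (0 : F) R' := fun k =>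
    hb _ (by have := (hps k).2.1; simp; linarith) _ (hrV (hps k).2.2) (hzs k)
  obtain ⟨z, -, φ, hφ, hφz⟩ := (isCompact_closedBall (0 : F) R').tendsto_subseq hz
  refine ⟨⟨z, ?_, ?_⟩, ?_, ?_⟩
  · exact mem_of_tendsto_of_isClosed_graph h₁ (hfst.comp hφ.tendsto_atTop) hφz
      (Eventually.of_forall fun k => (hzs (φ k)).1)
  · exact mem_of_tendsto_of_isClosed_graph h₂ hφz (hsnd.comp hφ.tendsto_atTop)
      (Eventually.of_forall fun k => (hzs (φ k)).2)
  · exact ge_of_tendsto' hfst.norm fun k => (hps k).2.1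
  · exact Metric.isClosed_closedBall.mem_of_tendsto hsnd
      (Eventually.of_forall fun k => (hps k).2.2)

end Graphs

/-! ### Minimizers of the penalized distance -/

section Penalty

variable {E F G : Type*}
  [NormedAddCommGroup E] [NormedAddCommGroup F] [NormedAddCommGroup G]

/-- The squared distance of `(x, z, y)` to `(a, b, c)`, with the coupling `z = z'` penalized. -/
def penalty (a : E) (b : F) (c : G) (j : ℝ) (q : E × F × F × G) : ℝ :=
  ‖a - q.1‖ ^ 2 + ‖b - q.2.1‖ ^ 2 + ‖c - q.2.2.2‖ ^ 2 + j * ‖q.2.1 - q.2.2.1‖ ^ 2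

theorem continuous_penalty (a : E) (b : F) (c : G) (j : ℝ) : Continuous (penalty a b c j) := by
  unfold penalty
  fun_prop

/-- The pairs consisting of a point of `gph Φ₁` and a point of `gph Φ₂`. -/
def graphPairs (Φ₁ : E → Set F) (Φ₂ : F → Set G) : Set (E × F × F × G) :=
  {q | q.2.1 ∈ Φ₁ q.1 ∧ q.2.2.2 ∈ Φ₂ q.2.2.1}

theorem isClosed_graphPairs {Φ₁ : E → Set F} {Φ₂ : F → Set G}
    (h₁ : IsClosed (graph Φ₁)) (h₂ : IsClosed (graph Φ₂)) : IsClosed (graphPairs Φ₁ Φ₂) := by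
  have c₁ : Continuous fun q : E × F × F × G => WithLp.toLp 2 (q.1, q.2.1) :=
    (WithLp.prod_continuous_toLp 2 E F).comp (by fun_prop)
  have c₂ : Continuous fun q : E × F × F × G => WithLp.toLp 2 (q.2.2.1, q.2.2.2) :=
    (WithLp.prod_continuous_toLp 2 F G).comp (by fun_prop)
  exact (h₁.preimage c₁).inter (h₂.preimage c₂)

/-- The penalty does not measure `z'` against `b` directly; the coupling term with `j ≥ 1` does so
through `z`, hence the radius `2 * r`. -/
theorem penalty_le_subset_prod (a : E) (b : F) (c : G) {j M r : ℝ} (hj : 1 ≤ j) (hr : 0 ≤ r)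
    (hM : M ≤ r ^ 2) :
    {q | penalty a b c j q ≤ M} ⊆ Metric.closedBall a r ×ˢ Metric.closedBall b r ×ˢ
      Metric.closedBall b (2 * r) ×ˢ Metric.closedBall c r := by
  rintro ⟨x, z, z', y⟩ hq
  simp only [penalty, Set.mem_ofPred_eq] at hq
  have e1 := sq_nonneg ‖a - x‖
  have e2 := sq_nonneg ‖b - z‖
  have e3 := sq_nonneg ‖c - y‖
  have e4 := sq_nonneg ‖z - z'‖
  have e5 : ‖z - z'‖ ^ 2 ≤ j * ‖z - z'‖ ^ 2 := le_mul_of_one_le_left e4 hj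
  have f1 : ‖a - x‖ ≤ r := by apply le_of_sq_le_sq _ hr; linarith
  have f2 : ‖b - z‖ ≤ r := by apply le_of_sq_le_sq _ hr; linarith
  have f3 : ‖c - y‖ ≤ r := by apply le_of_sq_le_sq _ hr; linarith
  have f4 : ‖z - z'‖ ≤ r := by apply le_of_sq_le_sq _ hr; linarith
  have f5 : ‖b - z'‖ ≤ 2 * r := by
    have := norm_add_le (b - z) (z - z')
    rw [sub_add_sub_cancel] at this
    linarith
  simp only [Set.mem_prod, Metric.mem_closedBall, dist_eq_norm']
  exact ⟨f1, f2, f5, f3⟩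

variable [ProperSpace E] [ProperSpace F] [ProperSpace G]

/-- The sublevel set through `q₀` is compact, and points outside it have larger values. -/
theorem exists_isMinOn_penalty {Φ₁ : E → Set F} {Φ₂ : F → Set G}
    (h₁ : IsClosed (graph Φ₁)) (h₂ : IsClosed (graph Φ₂)) (a : E) (b : F) (c : G) {j : ℝ}
    (hj : 1 ≤ j) {q₀ : E × F × F × G} (hq₀ : q₀ ∈ graphPairs Φ₁ Φ₂) :
    ∃ q ∈ graphPairs Φ₁ Φ₂, IsMinOn (penalty a b c j) (graphPairs Φ₁ Φ₂) q := by
  have hM : 0 ≤ penalty a b c j q₀ := by unfold penalty; positivity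
  have hK : IsCompact (graphPairs Φ₁ Φ₂ ∩ {q | penalty a b c j q ≤ penalty a b c j q₀}) := by
    refine IsCompact.of_isClosed_subset ((isCompact_closedBall a _).prod
      ((isCompact_closedBall b _).prod ((isCompact_closedBall b _).prod
      (isCompact_closedBall c _)))) ((isClosed_graphPairs h₁ h₂).inter
      (isClosed_le (continuous_penalty a b c j) continuous_const))
      (Set.inter_subset_right.trans (penalty_le_subset_prod a b c hj
        (Real.sqrt_nonneg _) (Real.sq_sqrt hM).ge))
  obtain ⟨q, hq, hmin⟩ := hK.exists_isMinOn ⟨q₀, hq₀, le_refl (penalty a b c j q₀)⟩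
    (continuous_penalty a b c j).continuousOn
  refine ⟨q, hq.1, fun q' hq' => ?_⟩
  by_cases h : penalty a b c j q' ≤ penalty a b c j q₀
  · exact hmin ⟨hq', h⟩
  · exact hq.2.trans (not_le.1 h).le

/-- For large penalties there are minimizers near the set of the projections of `(a, b, c)`. -/
theorem exists_isMinOn_penalty_mem {Φ₁ : E → Set F} {Φ₂ : F → Set G}
    (h₁ : IsClosed (graph Φ₁)) (h₂ : IsClosed (graph Φ₂)) (a : E) (b : F) (c : G)
    {x₀ : E} {z₀ : F} {y₀ : G} (hz₀ : z₀ ∈ Φ₁ x₀) (hy₀ : y₀ ∈ Φ₂ z₀)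
    {U : Set (E × F × F × G)} (hU : IsOpen U)
    (hmem : ∀ x z y, z ∈ Φ₁ x → y ∈ Φ₂ z →
      ‖a - x‖ ^ 2 + ‖b - z‖ ^ 2 + ‖c - y‖ ^ 2 ≤ ‖a - x₀‖ ^ 2 + ‖b - z₀‖ ^ 2 + ‖c - y₀‖ ^ 2 →
      (x, z, z, y) ∈ U) :
    ∃ j : ℝ, 1 ≤ j ∧ ∃ q ∈ graphPairs Φ₁ Φ₂, q ∈ U ∧
      IsMinOn (penalty a b c j) (graphPairs Φ₁ Φ₂) q := by
  set M := ‖a - x₀‖ ^ 2 + ‖b - z₀‖ ^ 2 + ‖c - y₀‖ ^ 2 with hMdef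
  have hM : 0 ≤ M := by positivity
  have hq₀ : (x₀, z₀, z₀, y₀) ∈ graphPairs Φ₁ Φ₂ := ⟨hz₀, hy₀⟩
  have hj : ∀ k : ℕ, (1 : ℝ) ≤ (k : ℝ) + 1 := fun k => by linarith [k.cast_nonneg (α := ℝ)]
  choose q hqS hqmin using fun k : ℕ => exists_isMinOn_penalty h₁ h₂ a b c (hj k) hq₀
  have hle : ∀ k : ℕ, penalty a b c (k + 1) (q k) ≤ M := fun k => by
    have : penalty a b c (k + 1) (q k) ≤ penalty a b c (k + 1) (x₀, z₀, z₀, y₀) :=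
      hqmin k hq₀
    simpa [penalty, hMdef] using this
  obtain ⟨⟨x, z, z', y⟩, -, φ, hφ, hlim⟩ := ((isCompact_closedBall a _).prod
      ((isCompact_closedBall b _).prod ((isCompact_closedBall b _).prod
      (isCompact_closedBall c _)))).tendsto_subseq
      fun k => penalty_le_subset_prod a b c (hj k) (Real.sqrt_nonneg M) (Real.sq_sqrt hM).ge (hle k)
  have hS : (x, z, z', y) ∈ graphPairs Φ₁ Φ₂ :=
    (isClosed_graphPairs h₁ h₂).mem_of_tendsto hlim (Eventually.of_forall fun k => hqS _)
  have hzz : ‖z - z'‖ ^ 2 ≤ 0 := by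
    have l1 : Tendsto (fun k => ‖(q (φ k)).2.1 - (q (φ k)).2.2.1‖ ^ 2) atTop
        (𝓝 (‖z - z'‖ ^ 2)) := by
      have : Continuous fun q : E × F × F × G => ‖q.2.1 - q.2.2.1‖ ^ 2 := by fun_prop
      exact (this.tendsto (x, z, z', y)).comp hlim
    -- Since the total penalty is at most `M`, the squared gap is at most `M / (k + 1)`.
    have l2 : Tendsto (fun k : ℕ => M * (1 / ((k : ℝ) + 1))) atTop (𝓝 0) := by
      simpa using tendsto_one_div_add_atTop_nhds_zero_nat.const_mul M
    refine le_of_tendsto_of_tendsto' l1 (l2.comp hφ.tendsto_atTop) fun k => ?_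
    have h := hle (φ k)
    simp only [penalty] at h
    simp only [Function.comp, mul_one_div]
    rw [le_div_iff₀ (by positivity)]
    nlinarith [sq_nonneg ‖a - (q (φ k)).1‖, sq_nonneg ‖b - (q (φ k)).2.1‖,
      sq_nonneg ‖c - (q (φ k)).2.2.2‖]
  obtain rfl : z = z' := by
    rw [← sub_eq_zero, ← norm_eq_zero]
    exact pow_eq_zero_iff two_ne_zero |>.1 (le_antisymm hzz (sq_nonneg _))
  -- Weight `0` drops the coupling term, leaving the squared distance bounded in `hmem`.
  have hlimle : penalty a b c 0 (x, z, z, y) ≤ M := by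
    refine le_of_tendsto' (((continuous_penalty a b c 0).tendsto _).comp hlim) fun k => ?_
    refine le_trans ?_ (hle (φ k))
    simp only [penalty, Function.comp]
    gcongr
    positivity
  have hxU := hmem x z y hS.1 hS.2 (by simpa [penalty] using hlimle)
  obtain ⟨k, hk⟩ := (hlim.eventually (hU.mem_nhds hxU)).exists
  exact ⟨_, hj (φ k), q (φ k), hqS _, hk, hqmin _⟩

end Penalty

/-! ### The fuzzy chain rule -/

section FuzzyChainRule

variable {E F G : Type*}
  [NormedAddCommGroup E] [InnerProductSpace ℝ E]
  [NormedAddCommGroup F] [InnerProductSpace ℝ F]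
  [NormedAddCommGroup G] [InnerProductSpace ℝ G]

omit [NormedAddCommGroup F] [InnerProductSpace ℝ F] [NormedAddCommGroup G]
  [InnerProductSpace ℝ G] in
theorem norm_sub_sq_expand (u p p' : E) :
    ‖u - p'‖ ^ 2 = ‖u - p‖ ^ 2 - 2 * inner ℝ (u - p) (p' - p) + ‖p' - p‖ ^ 2 := by
  rw [← norm_sub_sq_real, sub_sub_sub_cancel_right]

/-- A minimizer of a quadratic function on a graph yields a regular normal. -/
theorem mem_regularNormalCone_of_quadratic {Φ : E → Set F} {x g : E} {y h : F} {C : ℝ}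
    (hy : y ∈ Φ x) (hmin : ∀ x', ∀ y' ∈ Φ x', inner ℝ g (x' - x) + inner ℝ h (y' - y) ≤
      C * (‖x' - x‖ ^ 2 + ‖y' - y‖ ^ 2)) :
    WithLp.toLp 2 (g, h) ∈ regularNormalCone (graph Φ) (WithLp.toLp 2 (x, y)) := by
  refine mem_regularNormalCone_of_inner_le_sq (C := C) hy fun q hq => ?_
  rw [WithLp.prod_inner_apply, WithLp.prod_norm_sq_eq_of_L2]
  exact hmin q.fst q.snd hq

theorem mem_regularNormalCone_of_isMinOn_penalty {Φ₁ : E → Set F} {Φ₂ : F → Set G}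
    {a x : E} {b z z' : F} {c y : G} {j t : ℝ} (hj : 0 ≤ j) (ht : 0 < t)
    (hq : (x, z, z', y) ∈ graphPairs Φ₁ Φ₂)
    (hmin : IsMinOn (penalty a b c j) (graphPairs Φ₁ Φ₂) (x, z, z', y)) :
    WithLp.toLp 2 (t⁻¹ • (a - x), t⁻¹ • (b - z) - (t⁻¹ * j) • (z - z')) ∈
        regularNormalCone (graph Φ₁) (WithLp.toLp 2 (x, z)) ∧
      WithLp.toLp 2 ((t⁻¹ * j) • (z - z'), t⁻¹ • (c - y)) ∈
        regularNormalCone (graph Φ₂) (WithLp.toLp 2 (z', y)) := by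
  have hC : 0 ≤ t⁻¹ / 2 := by positivity
  have htt : 0 < t⁻¹ := inv_pos.2 ht
  constructor
  -- Only the point of `gph Φ₁` moves. The quadratic remainder has weight `1` in `x` and `1 + j` in
  -- `z`; `hx` supplies the missing `j` in `x`.
  · refine mem_regularNormalCone_of_quadratic (C := t⁻¹ / 2 * (1 + j)) hq.1 fun x₁ z₁ h₁ => ?_
    have h : penalty a b c j (x, z, z', y) ≤ penalty a b c j (x₁, z₁, z', y) :=
      hmin (show (x₁, z₁, z', y) ∈ graphPairs Φ₁ Φ₂ from ⟨h₁, hq.2⟩)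
    simp only [penalty] at h
    rw [norm_sub_sq_expand a x x₁, norm_sub_sq_expand b z z₁, norm_sub_rev z₁ z',
      norm_sub_sq_expand z' z z₁, norm_sub_rev z' z, ← neg_sub z z', inner_neg_left] at h
    rw [inner_sub_left, real_inner_smul_left, real_inner_smul_left, real_inner_smul_left]
    have hx : 0 ≤ j * ‖x₁ - x‖ ^ 2 := by positivity
    have := mul_nonneg hC (add_nonneg (sub_nonneg.2 h) hx)
    linarith
  · refine mem_regularNormalCone_of_quadratic (C := t⁻¹ / 2 * (1 + j)) hq.2 fun z₁ y₁ h₁ => ?_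
    have h : penalty a b c j (x, z, z', y) ≤ penalty a b c j (x, z, z₁, y₁) :=
      hmin (show (x, z, z₁, y₁) ∈ graphPairs Φ₁ Φ₂ from ⟨hq.1, h₁⟩)
    simp only [penalty] at h
    rw [norm_sub_sq_expand c y y₁, norm_sub_sq_expand z z' z₁] at h
    rw [real_inner_smul_left, real_inner_smul_left]
    have hx : 0 ≤ ‖z₁ - z'‖ ^ 2 + j * ‖y₁ - y‖ ^ 2 := by positivity
    have := mul_nonneg hC (add_nonneg (sub_nonneg.2 h) hx)
    linarith

variable [ProperSpace E] [ProperSpace F] [ProperSpace G]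

/-- The fuzzy chain rule: a regular normal to the graph of `Φ₂ ∘ Φ₁` is approximated by sums of
regular normals to the graphs of `Φ₁` and `Φ₂` at nearby points. -/
theorem exists_regularNormalCone_near_of_comp {Φ₁ : E → Set F} {Φ₂ : F → Set G}
    (h₁ : IsClosed (graph Φ₁)) (h₂ : IsClosed (graph Φ₂)) {x₀ u : E} {z₀ : F} {y₀ v : G}
    (hz₀ : z₀ ∈ Φ₁ x₀) (hy₀ : y₀ ∈ Φ₂ z₀)
    (huv : WithLp.toLp 2 (u, v) ∈ regularNormalCone (graph (comp Φ₂ Φ₁)) (WithLp.toLp 2 (x₀, y₀)))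
    {η : ℝ} (hη : 0 < η) :
    ∃ (x a : E) (z z' b w : F) (y c : G),
      (‖x - x₀‖ ≤ η ∧ ‖z - z₀‖ ≤ η ∧ ‖z' - z₀‖ ≤ η ∧ ‖y - y₀‖ ≤ η) ∧
      (‖a - u‖ ≤ η ∧ ‖b‖ ≤ η ∧ ‖c - v‖ ≤ η) ∧
      WithLp.toLp 2 (a, b - w) ∈ regularNormalCone (graph Φ₁) (WithLp.toLp 2 (x, z)) ∧
      WithLp.toLp 2 (w, c) ∈ regularNormalCone (graph Φ₂) (WithLp.toLp 2 (z', y)) := by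
  obtain ⟨-, hn⟩ := huv
  have hev := hn (η / 3) (by positivity)
  rw [eventually_nhdsWithin_iff, Metric.eventually_nhds_iff] at hev
  obtain ⟨δ, hδ, hnear⟩ := hev
  set N := ‖(WithLp.toLp 2 (u, v) : WithLp 2 (E × G))‖ with hN
  have hN0 : 0 ≤ N := norm_nonneg _
  obtain ⟨t, ht, ht1, htδ⟩ : ∃ t : ℝ, 0 < t ∧ t ≤ 1 ∧ 2 * t * N < δ := by
    refine ⟨min 1 (δ / (4 * (N + 1))), by positivity, min_le_left _ _, ?_⟩
    have h : min 1 (δ / (4 * (N + 1))) ≤ δ / (4 * (N + 1)) := min_le_right _ _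
    rw [le_div_iff₀ (by positivity)] at h
    have h0 : 0 < min 1 (δ / (4 * (N + 1))) := by positivity
    nlinarith
  have hU : IsOpen (Metric.ball x₀ (t * η) ×ˢ Metric.ball z₀ (t * η) ×ˢ Metric.ball z₀ (t * η) ×ˢ
      Metric.ball y₀ (t * η)) :=
    Metric.isOpen_ball.prod (Metric.isOpen_ball.prod (Metric.isOpen_ball.prod Metric.isOpen_ball))
  obtain ⟨j, hj, ⟨x, z, z', y⟩, hS, hmem, hmin⟩ := exists_isMinOn_penalty_mem h₁ h₂
    (x₀ + t • u) z₀ (y₀ + t • v) hz₀ hy₀ hU (by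
      intro x z y hz hy hle
      rw [norm_sub_sq_expand _ x₀ x, norm_sub_sq_expand _ y₀ y, sub_self, norm_zero,
        add_sub_cancel_left, add_sub_cancel_left, real_inner_smul_left,
        real_inner_smul_left] at hle
      set d : WithLp 2 (E × G) := WithLp.toLp 2 (x, y) - WithLp.toLp 2 (x₀, y₀) with hd
      have hd2 : ‖d‖ ^ 2 = ‖x - x₀‖ ^ 2 + ‖y - y₀‖ ^ 2 := WithLp.prod_norm_sq_eq_of_L2 d
      have hinner : inner ℝ (WithLp.toLp 2 (u, v)) d = inner ℝ u (x - x₀) + inner ℝ v (y - y₀) :=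
        WithLp.prod_inner_apply _ d
      -- The cost `‖t • u‖ ^ 2 + ‖t • v‖ ^ 2` of the reference point cancels.
      have hkey : ‖d‖ ^ 2 + ‖z₀ - z‖ ^ 2 ≤ 2 * t * inner ℝ (WithLp.toLp 2 (u, v)) d := by
        rw [hd2, hinner]; linarith
      have hd0 : 0 ≤ ‖d‖ := norm_nonneg d
      have hcs : inner ℝ (WithLp.toLp 2 (u, v)) d ≤ N * ‖d‖ := real_inner_le_norm _ d
      have hz0 : 0 ≤ ‖z₀ - z‖ ^ 2 := sq_nonneg _
      -- Cauchy–Schwarz gives `‖d‖ ≤ 2 * t * N`, which brings `d` into the range of the regular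
      -- normal inequality.
      have hdδ : ‖d‖ < δ := by
        refine lt_of_le_of_lt ?_ htδ
        by_contra! hlt
        have hpos : 0 < ‖d‖ := lt_of_le_of_lt (by positivity) hlt
        have := mul_le_mul_of_nonneg_left hcs (by positivity : 0 ≤ 2 * t)
        nlinarith
      have hε : inner ℝ (WithLp.toLp 2 (u, v)) d ≤ η / 3 * ‖d‖ :=
        hnear (by rw [dist_eq_norm]; exact hdδ) ⟨z, hz, hy⟩
      -- The displacement is at most `2/3` of `t * η`, so it remains at most `η` after division by
      -- `t`.
      have hd3 : ‖d‖ ≤ 2 * t * (η / 3) := by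
        by_contra! hlt
        have hpos : 0 < ‖d‖ := lt_of_le_of_lt (by positivity) hlt
        have := mul_le_mul_of_nonneg_left hε (by positivity : 0 ≤ 2 * t)
        nlinarith
      have hz3 : ‖z₀ - z‖ ≤ 2 * t * (η / 3) := by
        refine le_of_sq_le_sq ?_ (by positivity)
        have h1 := mul_le_mul_of_nonneg_left hε (by positivity : 0 ≤ 2 * t)
        have h2 := mul_le_mul_of_nonneg_left hd3 (by positivity : 0 ≤ 2 * t * (η / 3))
        nlinarith [sq_nonneg ‖d‖]
      have hx3 : ‖x - x₀‖ ≤ ‖d‖ :=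
        le_of_sq_le_sq (by linarith [sq_nonneg ‖y - y₀‖]) hd0
      have hy3 : ‖y - y₀‖ ≤ ‖d‖ :=
        le_of_sq_le_sq (by linarith [sq_nonneg ‖x - x₀‖]) hd0
      have htη : 0 < t * η := by positivity
      rw [norm_sub_rev] at hz3
      simp only [Set.mem_prod, Metric.mem_ball, dist_eq_norm]
      refine ⟨?_, ?_, ?_, ?_⟩ <;> linarith)
  simp only [Set.mem_prod, Metric.mem_ball, dist_eq_norm] at hmem
  obtain ⟨hx, hz, hz', hy⟩ := hmem
  obtain ⟨hn₁, hn₂⟩ := mem_regularNormalCone_of_isMinOn_penalty (by linarith) ht hS hmin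
  have htη : t * η ≤ η := mul_le_of_le_one_left hη.le ht1
  have hscale : ∀ s : ℝ, s < t * η → t⁻¹ * s ≤ η := fun s hs => by
    rw [inv_mul_le_iff₀ ht]; exact hs.le
  refine ⟨x, _, z, z', _, _, y, _, ⟨by linarith, by linarith, by linarith, by linarith⟩,
    ⟨?_, ?_, ?_⟩, hn₁, hn₂⟩
  · have : t⁻¹ • (x₀ + t • u - x) - u = t⁻¹ • (x₀ - x) := by
      rw [add_sub_right_comm, smul_add, inv_smul_smul₀ ht.ne', add_sub_cancel_right]
    rw [this, norm_smul, norm_inv, Real.norm_of_nonneg ht.le, norm_sub_rev]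
    exact hscale _ hx
  · rw [norm_smul, norm_inv, Real.norm_of_nonneg ht.le, norm_sub_rev]
    exact hscale _ hz
  · have : t⁻¹ • (y₀ + t • v - y) - v = t⁻¹ • (y₀ - y) := by
      rw [add_sub_right_comm, smul_add, inv_smul_smul₀ ht.ne', add_sub_cancel_right]
    rw [this, norm_smul, norm_inv, Real.norm_of_nonneg ht.le, norm_sub_rev]
    exact hscale _ hy

end FuzzyChainRule

/-! ### Passage to the limit at infinity -/

section ChainRule

theorem tendsto_of_norm_sub_le_one_div {K : Type*} [NormedAddCommGroup K] {p q : ℕ → K} {l : K}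
    (hq : Tendsto q atTop (𝓝 l)) (hpq : ∀ k, ‖p k - q k‖ ≤ 1 / ((k : ℝ) + 1)) :
    Tendsto p atTop (𝓝 l) := by
  simpa using (squeeze_zero_norm hpq tendsto_one_div_add_atTop_nhds_zero_nat).add hq

variable {E F G : Type*}
  [NormedAddCommGroup E] [InnerProductSpace ℝ E] [ProperSpace E]
  [NormedAddCommGroup F] [InnerProductSpace ℝ F] [ProperSpace F]
  [NormedAddCommGroup G] [InnerProductSpace ℝ G] [ProperSpace G]

/-- The chain rule at infinity along a fixed intermediate limit point. -/
theorem mem_comp_coderivative_of_tendsto {Φ₁ : E → Set F} {Φ₂ : F → Set G}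
    (h₁ : IsClosed (graph Φ₁)) (h₂ : IsClosed (graph Φ₂)) {u : E} {z : F} {y v : G}
    (hcq : coderivative Φ₂ z y 0 ∩ kernel (coderivativeAtInfty Φ₁ z) ⊆ {0})
    {xs us : ℕ → E} {zs : ℕ → F} {ys vs : ℕ → G}
    (hx : Tendsto (fun k => ‖xs k‖) atTop atTop) (hz : Tendsto zs atTop (𝓝 z))
    (hy : Tendsto ys atTop (𝓝 y)) (hu : Tendsto us atTop (𝓝 u))
    (hv : Tendsto vs atTop (𝓝 (-v)))
    (hzs : ∀ k, zs k ∈ Φ₁ (xs k)) (hys : ∀ k, ys k ∈ Φ₂ (zs k))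
    (hn : ∀ k, WithLp.toLp 2 (us k, vs k) ∈
      regularNormalCone (graph (comp Φ₂ Φ₁)) (WithLp.toLp 2 (xs k, ys k))) :
    u ∈ comp (coderivativeAtInfty Φ₁ z) (coderivative Φ₂ z y) v := by
  have hpos : ∀ k : ℕ, (0 : ℝ) < 1 / ((k : ℝ) + 1) := fun k => by positivity
  choose x a ζ ζ' b w y' c hnear hnear' hn₁ hn₂ using fun k =>
    exists_regularNormalCone_near_of_comp h₁ h₂ (hzs k) (hys k) (hn k) (hpos k)
  have hζ := tendsto_of_norm_sub_le_one_div hz fun k => (hnear k).2.1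
  have hζ' := tendsto_of_norm_sub_le_one_div hz fun k => (hnear k).2.2.1
  have hy' := tendsto_of_norm_sub_le_one_div hy fun k => (hnear k).2.2.2
  have ha := tendsto_of_norm_sub_le_one_div hu fun k => (hnear' k).1
  have hb : Tendsto b atTop (𝓝 0) :=
    squeeze_zero_norm (fun k => (hnear' k).2.1) tendsto_one_div_add_atTop_nhds_zero_nat
  have hc := tendsto_of_norm_sub_le_one_div hv fun k => (hnear' k).2.2
  have hxtop : Tendsto (fun k => ‖x k‖) atTop atTop := by
    refine tendsto_atTop_mono (fun k => ?_) (tendsto_atTop_add_const_right atTop (-1) hx)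
    have h1 := norm_sub_norm_le (xs k) (x k)
    rw [norm_sub_rev] at h1
    have h2 : 1 / ((k : ℝ) + 1) ≤ 1 :=
      (div_le_one (by positivity)).2 (by linarith [k.cast_nonneg (α := ℝ)])
    linarith [(hnear k).1]
  -- Normalize the multipliers and extract a convergent subsequence.
  set r : ℕ → ℝ := fun k => (1 + ‖w k‖)⁻¹ with hr
  have hden : ∀ k, 0 < 1 + ‖w k‖ := fun k => by positivity
  have hrpos : ∀ k, 0 < r k := fun k => inv_pos.2 (hden k)
  -- From `r + ‖r • w‖ = 1`, the pairs `(r, r • w)` are bounded and cannot tend to zero.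
  have hrw : ∀ k, ‖r k • w k‖ = 1 - r k := fun k => by
    rw [norm_smul, Real.norm_of_nonneg (hrpos k).le, eq_sub_iff_add_eq, hr]
    have := (hden k).ne'
    field_simp
    ring
  have hrmem : ∀ k, (r k, r k • w k) ∈ Set.Icc (0 : ℝ) 1 ×ˢ Metric.closedBall (0 : F) 1 :=
    fun k => by
      have h1 := hrw k
      have h2 := norm_nonneg (r k • w k)
      have h3 := hrpos k
      refine ⟨⟨h3.le, by linarith⟩, mem_closedBall_zero_iff.2 (by linarith)⟩
  obtain ⟨⟨μ, ω⟩, hμ, φ, hφ, hlim⟩ :=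
    (isCompact_Icc.prod (isCompact_closedBall (0 : F) 1)).tendsto_subseq hrmem
  have hφt := hφ.tendsto_atTop
  have hrlim : Tendsto (fun k => r (φ k)) atTop (𝓝 μ) := (continuous_fst.tendsto _).comp hlim
  have hwlim : Tendsto (fun k => r (φ k) • w (φ k)) atTop (𝓝 ω) :=
    (continuous_snd.tendsto _).comp hlim
  have hinfty : WithLp.toLp 2 (μ • u, -ω) ∈ normalConeAtInfty (graph Φ₁) z := by
    refine ⟨_, _, fun k => (hn₁ (φ k)).1, fun k => smul_mem_regularNormalCone (hrpos (φ k))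
      (hn₁ (φ k)), ⟨hxtop.comp hφt, hζ.comp hφt⟩, ?_⟩
    refine tendsto_toLp_prodMk (hrlim.smul (ha.comp hφt)) ?_
    have h := (hrlim.smul (hb.comp hφt)).sub hwlim
    rw [smul_zero, zero_sub] at h
    exact h.congr fun k => (smul_sub _ _ _).symm
  have hfin : WithLp.toLp 2 (ω, -(μ • v)) ∈
      limitingNormalCone (graph Φ₂) (WithLp.toLp 2 (z, y)) := by
    refine ⟨mem_of_tendsto_of_isClosed_graph h₂ hz hy (Eventually.of_forall hys), _, _,
      fun k => (hn₂ (φ k)).1, fun k => smul_mem_regularNormalCone (hrpos (φ k)) (hn₂ (φ k)),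
      tendsto_toLp_prodMk (hζ'.comp hφt) (hy'.comp hφt), ?_⟩
    rw [← smul_neg]
    exact tendsto_toLp_prodMk hwlim (hrlim.smul (hc.comp hφt))
  -- If `μ = 0`, the qualification gives `ω = 0`, whereas `‖ω‖ = 1 - μ = 1`.
  rcases hμ.1.1.eq_or_lt with rfl | hμpos
  · rw [zero_smul] at hinfty hfin
    have hω : ω = 0 := hcq ⟨hfin, hinfty⟩
    have h1 : ‖ω‖ = 1 - 0 := tendsto_nhds_unique hwlim.norm
      ((tendsto_const_nhds.sub hrlim).congr fun k => (hrw (φ k)).symm)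
    simp [hω] at h1
  -- Both cones are stable under positive scaling, so division by `μ` restores `u` and `-v`.
  · refine ⟨μ⁻¹ • ω, ?_, ?_⟩
    · have h := smul_mem_limitingNormalCone (inv_pos.2 hμpos) hfin
      rw [← WithLp.toLp_smul, Prod.smul_mk, smul_neg, inv_smul_smul₀ hμpos.ne'] at h
      exact h
    · have h := smul_mem_normalConeAtInfty (inv_pos.2 hμpos) hinfty
      rw [← WithLp.toLp_smul, Prod.smul_mk, inv_smul_smul₀ hμpos.ne', smul_neg] at h
      exact h

/-- The chain rule for coderivatives at infinity. -/
theorem coderivativeAtInfty_comp_subset {Φ₁ : E → Set F} {Φ₂ : F → Set G}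
    (h₁ : IsClosed (graph Φ₁)) (h₂ : IsClosed (graph Φ₂)) {y : G} {R R' : ℝ}
    {V : Set G} (hV : V ∈ 𝓝 y)
    (hb : ∀ x : E, x ∉ Metric.closedBall 0 R → ∀ y' ∈ V,
      Φ₁ x ∩ inverse Φ₂ y' ⊆ Metric.closedBall 0 R')
    (hcq : ∀ z ∈ jelonekComp Φ₂ Φ₁ y,
      coderivative Φ₂ z y 0 ∩ kernel (coderivativeAtInfty Φ₁ z) ⊆ {0}) (v : G) :
    coderivativeAtInfty (comp Φ₂ Φ₁) y v ⊆
      ⋃ z ∈ jelonekComp Φ₂ Φ₁ y, comp (coderivativeAtInfty Φ₁ z) (coderivative Φ₂ z y) v := by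
  rintro u ⟨ps, ξs, hmem, hn, ⟨hx, hy⟩, hξ⟩
  choose zs hzs using hmem
  have hev : ∀ᶠ k in atTop, zs k ∈ Metric.closedBall (0 : F) R' := by
    filter_upwards [hx.eventually_gt_atTop R, hy.eventually hV] with k h1 h2
    exact hb _ (by simpa using h1) _ h2 (hzs k)
  obtain ⟨z, -, φ, hφ, hz⟩ := (isCompact_closedBall (0 : F) R').tendsto_subseq' hev.frequently
  have hφt := hφ.tendsto_atTop
  have hJ : z ∈ jelonekComp Φ₂ Φ₁ y :=
    ⟨_, _, _, hx.comp hφt, fun k => (hzs (φ k)).1, fun k => (hzs (φ k)).2, hz, hy.comp hφt⟩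
  have hu := ((WithLp.prod_continuous_ofLp 2 E G).fst.tendsto _).comp (hξ.comp hφt)
  have hv := ((WithLp.prod_continuous_ofLp 2 E G).snd.tendsto _).comp (hξ.comp hφt)
  exact Set.mem_biUnion hJ (mem_comp_coderivative_of_tendsto h₁ h₂ (hcq z hJ) (hx.comp hφt) hz
    (hy.comp hφt) hu hv (fun k => (hzs (φ k)).1) (fun k => (hzs (φ k)).2) fun k => hn (φ k))

end ChainRule

end CoderivativeAtInfinity

theorem theorem3p9 {n p m : ℕ}
    (F₁ : EuclideanSpace ℝ (Fin n) → Set (EuclideanSpace ℝ (Fin p)))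
    (F₂ : EuclideanSpace ℝ (Fin p) → Set (EuclideanSpace ℝ (Fin m)))
    (hF₁ : IsClosed (CoderivativeAtInfinity.graph F₁))
    (hF₂ : IsClosed (CoderivativeAtInfinity.graph F₂))
    (y : EuclideanSpace ℝ (Fin m))
    (hy : y ∈ CoderivativeAtInfinity.jelonekSet (CoderivativeAtInfinity.comp F₂ F₁))
    -- the boundedness condition
    (hbdd : ∃ R : ℝ, 0 < R ∧ ∃ R' : ℝ, 0 < R' ∧ ∃ V ∈ 𝓝 y,
      ∀ x : EuclideanSpace ℝ (Fin n), x ∉ Metric.closedBall 0 R → ∀ y' ∈ V,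
        F₁ x ∩ CoderivativeAtInfinity.inverse F₂ y' ⊆ Metric.closedBall 0 R')
    -- the constraint qualification
    (hcq : ∀ z ∈ CoderivativeAtInfinity.jelonekComp F₂ F₁ y,
      CoderivativeAtInfinity.coderivative F₂ z y 0 ∩
        CoderivativeAtInfinity.kernel (CoderivativeAtInfinity.coderivativeAtInfty F₁ z) = {0}) :
    CoderivativeAtInfinity.LocallyClosedAtInfty
        (CoderivativeAtInfinity.graph (CoderivativeAtInfinity.comp F₂ F₁)) y ∧
      ∀ v : EuclideanSpace ℝ (Fin m),
        CoderivativeAtInfinity.coderivativeAtInfty (CoderivativeAtInfinity.comp F₂ F₁) y v ⊆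
          ⋃ z ∈ CoderivativeAtInfinity.jelonekComp F₂ F₁ y,
            CoderivativeAtInfinity.comp (CoderivativeAtInfinity.coderivativeAtInfty F₁ z)
              (CoderivativeAtInfinity.coderivative F₂ z y) v := by
  obtain ⟨R, hR, R', -, V, hV, hb⟩ := hbdd
  exact ⟨CoderivativeAtInfinity.locallyClosedAtInfty_graph_comp hF₁ hF₂ hR hV hb,
    CoderivativeAtInfinity.coderivativeAtInfty_comp_subset hF₁ hF₂ hV hb
      fun z hz => (hcq z hz).subset⟩
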